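/- \textbf{Setting.} Let $(X,\mathfrak A,\mu)$ be a standard Borel probability space with a continuous (atomless) measure. A \emph{filtration} is a decreasing sequence of $\sigma$-algebras $\mathfrak A=\mathfrak A_0\supset\mathfrak A_1\supset\mathfrak A_2\supset\cdots$, considered modulo null sets; $\xi_n$ is the measurable partition corresponding to $\mathfrak A_n$ (so $\xi_0$ is the partition into singletons), and $\mu_n^x$ is the conditional measure on the element of $\xi_n$ containing $x$. The filtration is \emph{ergodic} if every set in $\bigcap_n\mathfrak A_n$ has measure $0$ or $1$. It is of \emph{finite type} if for every $n$ almost all elements of $\xi_n$ are finite and only finitely many probability vectors occur as the vectors of conditional probabilities on the elements of $\xi_n$. \textbf{Standardness.} Let $\{x_n\}_{n\ge 0}$ be a (possibly time-inhomogeneous) Markov chain with finite state sets $S_n$, and let $\mathfrak A_n=\sigma(x_k:k\ge n)$ be the filtration generated by it. A \emph{cylinder semimetric} on $\prod_n S_n$ is a semimetric $\rho(y,z)$ depending only on finitely many initial coordinates of $y$ and $z$, and an \emph{almost cylinder metric} is a metric that is a uniform limit of cylinder semimetrics. Starting from such a metric $\rho_0=\rho$, evaluated on realizations of the chain, put $$\rho_{n+1}(x,y)=\inf_{\psi}\int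 \rho_n(a,b)\,d\psi(a,b),$$ where $\psi$ runs over all couplings of the conditional measures $\mu_{n+1}^x$ and $\mu_{n+1}^y$. The chain is \emph{standard} if its filtration is ergodic and, for some almost cylinder metric $\rho$, $$\lim_{n\to\infty}\int\!\!\int\rho_n(x,y)\,d\mu(x)\,d\mu(y)=0.$$ A filtration is \emph{standard} if, modulo null sets, it is the filtration generated by a standard Markov chain with finite state sets. \textbf{Theorem (general lacunary isomorphism theorem).} Every ergodic finite type filtration $\{\xi_n\}_{n\ge 0}$ is lacunary isomorphic to a standard filtration, i.e., there is a strictly increasing sequence $0=n_0<n_1<n_2<\cdots$ (so $n_k\to\infty$) such that the filtration $\{\xi_{n_k}\}_{k\ge 0}$ is standard. -/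

import Mathlib

open MeasureTheory ProbabilityTheory Filter Topology
open scoped ENNReal

namespace DecFiltration

noncomputable section

/-- The zero-one law: the intersection of the σ-algebras `A n` is trivial mod `μ`. -/
def IsErgodic {Ω : Type*} [MeasurableSpace Ω] (μ : Measure Ω)
    (A : ℕ → MeasurableSpace Ω) : Prop :=
  ∀ S : Set Ω, (∀ n, MeasurableSet[A n] S) → μ S = 0 ∨ μ S = 1

/-- A filtration of finite type. The conditional measure of the `n`-th partition on the element
containing `x` is `condExpKernel μ (A n) x`; for almost every `x` it lives on finitely many points
`z i`, and for each `n` only finitely many probability vectors of weights occur. -/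
def IsFiniteType {Ω : Type*} [MeasurableSpace Ω] [StandardBorelSpace Ω]
    (μ : Measure Ω) [IsFiniteMeasure μ] (A : ℕ → MeasurableSpace Ω) : Prop :=
  ∀ n, ∃ V : Set (Σ k : ℕ, Fin k → ℝ≥0∞), V.Finite ∧
    ∀ᵐ x ∂μ, ∃ p ∈ V, ∃ z : Fin p.1 → Ω, Function.Injective z ∧
      condExpKernel μ (A n) x = ∑ i, p.2 i • Measure.dirac (z i)

/-- The Kantorovich distance for a cost `d`: infimum of the mean cost over all couplings. -/
def kantorovich {Ω : Type*} [MeasurableSpace Ω] (d : Ω → Ω → ℝ≥0∞) (α β : Measure Ω) : ℝ≥0∞ :=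
  ⨅ (ψ : Measure (Ω × Ω)) (_ : ψ.map Prod.fst = α ∧ ψ.map Prod.snd = β),
    ∫⁻ z, d z.1 z.2 ∂ψ

/-- Transfer of a semimetric along the partition with conditional measures `κ x`, regarded as a
semimetric on the original space: the Kantorovich distance of the conditional measures. -/
def transfer {Ω : Type*} [MeasurableSpace Ω] (κ : Ω → Measure Ω) (d : Ω → Ω → ℝ≥0∞) :
    Ω → Ω → ℝ≥0∞ :=
  fun x y => kantorovich d (κ x) (κ y)

/-- The successive transfers `ρ₀, ρ₁, ρ₂, …`. Each `ρₙ` is a function on the quotient by the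
`n`-th partition pulled back to `Ω`, so its transfer along the `(n+1)`-st partition of `Ω` is the
pull-back of its transfer along the quotient of the `(n+1)`-st partition by the `n`-th one. -/
def iteratedTransfer {Ω : Type*} [MeasurableSpace Ω] [StandardBorelSpace Ω]
    (μ : Measure Ω) [IsFiniteMeasure μ] (A : ℕ → MeasurableSpace Ω) (d : Ω → Ω → ℝ≥0∞) :
    ℕ → Ω → Ω → ℝ≥0∞
  | 0 => d
  | n + 1 => transfer (fun x => condExpKernel μ (A (n + 1)) x) (iteratedTransfer μ A d n)

/-- The σ-algebra generated by the random variables with indices at least `n`. -/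
abbrev tailSigma {Ω : Type*} {s : ℕ → ℕ} (X : ∀ n, Ω → Fin (s n)) (n : ℕ) : MeasurableSpace Ω :=
  ⨆ k, ⨆ (_ : n ≤ k), MeasurableSpace.comap (X k) ⊤

/-- A (time-inhomogeneous) Markov chain with finite state sets. The Markov property, which is
symmetric under time reversal, is written in the backward direction: the conditional law of `X n`
given the whole future depends on `X (n + 1)` only. -/
structure IsMarkovChain {Ω : Type*} [MeasurableSpace Ω] (μ : Measure Ω)
    {s : ℕ → ℕ} (X : ∀ n, Ω → Fin (s n)) : Prop where
  measurable : ∀ n, Measurable (X n)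
  markov : ∀ n (a : Fin (s n)),
    μ⟦X n ⁻¹' {a} | tailSigma X (n + 1)⟧ =ᵐ[μ]
      μ⟦X n ⁻¹' {a} | MeasurableSpace.comap (X (n + 1)) ⊤⟧

/-- Semimetrics (distinct points may have distance zero). -/
structure IsSemimetric {P : Type*} (d : P → P → ℝ) : Prop where
  nonneg : ∀ x y, 0 ≤ d x y
  self : ∀ x, d x x = 0
  symm : ∀ x y, d x y = d y x
  triangle : ∀ x y z, d x z ≤ d x y + d y z

/-- `d` depends only on finitely many initial coordinates. -/
def IsCylinder {s : ℕ → ℕ} (d : (∀ n, Fin (s n)) → (∀ n, Fin (s n)) → ℝ) : Prop :=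
  ∃ N : ℕ, ∀ x x' y y' : (∀ n, Fin (s n)),
    (∀ n < N, x n = x' n) → (∀ n < N, y n = y' n) → d x y = d x' y'

/-- An almost cylinder metric on the compact path space: a metric that is a uniform limit of
cylinder semimetrics. -/
def IsAlmostCylinderMetric {s : ℕ → ℕ}
    (d : (∀ n, Fin (s n)) → (∀ n, Fin (s n)) → ℝ) : Prop :=
  IsSemimetric d ∧ (∀ x y, d x y = 0 → x = y) ∧
    ∃ c : ℕ → (∀ n, Fin (s n)) → (∀ n, Fin (s n)) → ℝ,
      (∀ m, IsSemimetric (c m) ∧ IsCylinder (c m)) ∧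
      ∀ ε > 0, ∃ M, ∀ m ≥ M, ∀ x y, |c m x y - d x y| < ε

/-- A standard Markov chain: it is ergodic, and for some initial metric on the path space the
iterated semimetrics collapse in the mean. -/
def IsStandardChain {Ω : Type*} [MeasurableSpace Ω] [StandardBorelSpace Ω]
    (μ : Measure Ω) [IsFiniteMeasure μ] {s : ℕ → ℕ} (X : ∀ n, Ω → Fin (s n)) : Prop :=
  IsMarkovChain μ X ∧ IsErgodic μ (tailSigma X) ∧
    ∃ d : (∀ n, Fin (s n)) → (∀ n, Fin (s n)) → ℝ, IsAlmostCylinderMetric d ∧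
      Tendsto
        (fun n => ∫⁻ p, iteratedTransfer μ (tailSigma X)
          (fun x y => ENNReal.ofReal (d (fun k => X k x) (fun k => X k y))) n p.1 p.2 ∂(μ.prod μ))
        atTop (𝓝 0)

/-- A standard filtration: it coincides mod null sets with the filtration generated by a standard
Markov chain with finite state sets. -/
def IsStandard {Ω : Type*} [MeasurableSpace Ω] [StandardBorelSpace Ω]
    (μ : Measure Ω) [IsFiniteMeasure μ] (A : ℕ → MeasurableSpace Ω) : Prop :=
  ∃ (s : ℕ → ℕ) (X : ∀ n, Ω → Fin (s n)),
    (∀ n, eventuallyMeasurableSpace (A n) (ae μ) =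
      eventuallyMeasurableSpace (tailSigma X n) (ae μ)) ∧
    IsStandardChain μ X

end

end DecFiltration

/-! Passing to a subsequence buys independence. By ergodicity, a finite partition fixed at level `n
k` is almost independent of `A (n (k + 1))` once `n (k + 1)` is large
(`exists_tendsto_condExpKernel`). Finite type keeps everything finite-valued: conditional
probabilities of finitely many events take finitely many values, and finitely many labels tell apart
the finer elements inside a coarse one (`exists_label`).

The choices alternate and are collected in a `Tower`. `Y k` records the conditional law given `A (n
k)` of the coordinates before `k`; then `n (k + 1)` makes `Y k` nearly independent of the next
σ-algebra; then `X k` joins `Y k` with a label of the elements at level `n k` inside those at level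
`n (k + 1)`. The conditional law of `X k` is thus a function of `Y (k + 1)`, hence of `X (k + 1)`:
the chain is Markov. The labels separate the points of each element and `Y k` also records the first
`k` generating sets, so the chain generates `A (n k)` modulo null sets.

For standardness, points with equal `Y k` have conditional measures that can be coupled backwards,
level by level, with equal coordinates before `k`. Hence the `k`-th transfer is at most the
indicator of differing `Y k`, plus `2⁻¹ ^ k` (`Tower.exists_pathTransfer_le_agree`). One more
transfer turns the indicator into a total variation distance between conditional laws of `Y k`,
which is small in the mean by the choice of `n (k + 1)`. -/

namespace DecFiltration

/-- The condition of finite type for a single σ-algebra. -/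
def FiniteTypeAt {Ω : Type*} (m : MeasurableSpace Ω) [MeasurableSpace Ω] [StandardBorelSpace Ω]
    (μ : Measure Ω) [IsFiniteMeasure μ] : Prop :=
  ∃ V : Set (Σ k : ℕ, Fin k → ℝ≥0∞), V.Finite ∧
    ∀ᵐ x ∂μ, ∃ p ∈ V, ∃ z : Fin p.1 → Ω, Function.Injective z ∧
      condExpKernel μ m x = ∑ i, p.2 i • Measure.dirac (z i)

/-! ### Conditional measures and the finite type condition. -/

section Kernel

variable {Ω : Type*} {m m' : MeasurableSpace Ω} [mΩ : MeasurableSpace Ω] [StandardBorelSpace Ω]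
  {μ : Measure Ω} [IsProbabilityMeasure μ]

lemma ae_ae_condExpKernel (hm : m ≤ mΩ) {p : Ω → Prop} (h : ∀ᵐ x ∂μ, p x) :
    ∀ᵐ x ∂μ, ∀ᵐ y ∂(condExpKernel μ m x), p y := by
  refine ae_of_ae_trim hm (Measure.ae_ae_of_ae_comp ?_)
  rwa [condExpKernel_comp_trim hm]

lemma ae_of_ae_ae_condExpKernel (hm : m ≤ mΩ) {p : Ω → Prop} (hp : MeasurableSet {x | p x})
    (h : ∀ᵐ x ∂μ, ∀ᵐ y ∂(condExpKernel μ m x), p y) : ∀ᵐ x ∂μ, p x := by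
  have hmeas : MeasurableSet[m] {x | condExpKernel μ m x {x | p x}ᶜ = 0} :=
    measurable_condExpKernel hp.compl (measurableSet_singleton 0)
  have h1 : ∀ᵐ x ∂(μ.trim hm), condExpKernel μ m x {x | p x}ᶜ = 0 := by
    rw [ae_iff, ← Set.compl_ofPred, trim_measurableSet_eq hm (MeasurableSet.compl hmeas)]
    exact ae_iff.1 (h.mono fun x hx => hx)
  rw [← condExpKernel_comp_trim (μ := μ) hm]
  exact Measure.ae_comp_of_ae_ae hp h1

/-- An `m`-measurable function is constant on the elements of the partition: the joint law of a
point and a conditional sample, with `m` on the first factor, is the image of `μ` on the diagonal.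
-/
lemma ae_condExpKernel_eq_self {β : Type*} [MeasurableSpace β] [MeasurableEq β]
    (hm : m ≤ mΩ) {f : Ω → β} (hf : Measurable[m] f) :
    ∀ᵐ x ∂μ, ∀ᵐ y ∂(condExpKernel μ m x), f y = f x := by
  refine ae_of_ae_trim hm (Measure.ae_ae_of_ae_compProd (p := fun z : Ω × Ω => f z.2 = f z.1) ?_)
  rw [compProd_trim_condExpKernel]
  have h1 : @Measurable _ _ (@Prod.instMeasurableSpace _ _ m mΩ) _ (fun z : Ω × Ω => f z.2) :=
    (hf.mono hm le_rfl).comp (@measurable_snd _ _ m mΩ)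
  have h2 : @Measurable _ _ (@Prod.instMeasurableSpace _ _ m mΩ) _ (fun z : Ω × Ω => f z.1) :=
    hf.comp (@measurable_fst _ _ m mΩ)
  have hd : @Measurable _ _ mΩ (@Prod.instMeasurableSpace _ _ m mΩ) (Function.diag : Ω → Ω × Ω) :=
    @Measurable.prodMk Ω mΩ Ω Ω m mΩ id id (measurable_id'' hm) measurable_id
  have hs : @MeasurableSet _ (@Prod.instMeasurableSpace _ _ m mΩ) {z : Ω × Ω | f z.2 = f z.1} :=
    (@Measurable.prodMk _ (@Prod.instMeasurableSpace _ _ m mΩ) _ _ _ _ _ _ h1 h2)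
      measurableSet_diagonal
  refine (@ae_map_iff _ _ mΩ (@Prod.instMeasurableSpace _ _ m mΩ) _ _
    (@Measurable.aemeasurable _ _ mΩ (@Prod.instMeasurableSpace _ _ m mΩ) _ _ hd) _ hs).2 ?_
  exact Eventually.of_forall fun x => rfl

lemma condExpKernel_apply_eq_indicator (hm : m ≤ mΩ) {S : Set Ω} (hS : MeasurableSet[m] S) :
    ∀ᵐ x ∂μ, condExpKernel μ m x S = S.indicator 1 x := by
  have hmem : Measurable[m] fun x => x ∈ S := (@measurable_mem Ω S m).2 hS
  filter_upwards [ae_condExpKernel_eq_self (μ := μ) hm hmem] with x hx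
  by_cases hxS : x ∈ S
  · rw [Set.indicator_of_mem hxS, Pi.one_apply]
    exact (prob_compl_eq_zero_iff (hm _ hS)).1 (hx.mono fun y hy => hy.symm.mp hxS)
  · rw [Set.indicator_of_notMem hxS]
    have : ∀ᵐ y ∂(condExpKernel μ m x), y ∉ S := hx.mono fun y hy => by
      intro h; exact hxS (hy.mp h)
    simpa [ae_iff] using this

/-- A real function, measurable with respect to `m`, whose fibres separate the conditional
measures. -/
lemma exists_code : ∃ f : Ω → ℝ, Measurable[m] f ∧
    ∀ x y, f x = f y → condExpKernel μ m x = condExpKernel μ m y := by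
  have he := measurableEmbedding_embeddingReal Ω
  let F : Ω → (ℚ × ℚ → ℝ≥0∞) := fun x q =>
    condExpKernel μ m x (embeddingReal Ω ⁻¹' Set.Ioo (q.1 : ℝ) q.2)
  have hF : Measurable[m] F :=
    @measurable_pi_lambda _ _ _ m _ _
      fun q => measurable_condExpKernel (he.measurable measurableSet_Ioo)
  have hg := measurableEmbedding_embeddingReal (ℚ × ℚ → ℝ≥0∞)
  refine ⟨fun x => embeddingReal _ (F x), hg.measurable.comp hF, fun x y hxy => ?_⟩
  have hxy' : F x = F y := hg.injective hxy
  have hmap : (condExpKernel μ m x).map (embeddingReal Ω)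
      = (condExpKernel μ m y).map (embeddingReal Ω) := by
    have := Measure.isProbabilityMeasure_map (μ := condExpKernel μ m x) he.measurable.aemeasurable
    refine Real.measure_ext_Ioo_rat fun a b => ?_
    rw [Measure.map_apply he.measurable measurableSet_Ioo,
      Measure.map_apply he.measurable measurableSet_Ioo]
    exact congrFun hxy' (a, b)
  rw [← he.comap_map (condExpKernel μ m x), hmap, he.comap_map]

lemma ae_condExpKernel_eq_condExpKernel (hm : m ≤ mΩ) :
    ∀ᵐ x ∂μ, ∀ᵐ y ∂(condExpKernel μ m x), condExpKernel μ m y = condExpKernel μ m x := by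
  obtain ⟨f, hf, hf'⟩ := exists_code (m := m) (μ := μ)
  filter_upwards [ae_condExpKernel_eq_self (μ := μ) hm hf] with x hx
  exact hx.mono fun y hy => hf' _ _ hy

/-- A finite sum of point masses charges almost every one of its own points, and the conditional
measure is almost surely constant along itself. -/
lemma ae_condExpKernel_singleton_pos (hm : m ≤ mΩ) (h : FiniteTypeAt m μ) :
    ∀ᵐ x ∂μ, 0 < condExpKernel μ m x {x} := by
  obtain ⟨V, -, hV⟩ := h
  refine ae_of_ae_ae_condExpKernel hm ?_ ?_
  · have h1 : Measurable fun x => condExpKernel μ m x (Prod.mk x ⁻¹' Set.diagonal Ω) := by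
      have := Kernel.measurable_kernel_prodMk_left (κ := (condExpKernel μ m).comap id
        (measurable_id'' hm)) (measurableSet_diagonal (α := Ω))
      simpa using this
    have h2 : ∀ x : Ω, Prod.mk x ⁻¹' Set.diagonal Ω = {x} := by
      intro x; ext y; simp [eq_comm]
    simp_rw [h2] at h1
    exact measurableSet_lt measurable_const h1
  · filter_upwards [hV, ae_condExpKernel_eq_condExpKernel (μ := μ) hm] with x hx hx'
    obtain ⟨p, -, z, -, hp⟩ := hx
    have h1 : ∀ᵐ y ∂(condExpKernel μ m x), 0 < condExpKernel μ m x {y} := by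
      rw [hp, ae_iff]
      simp only [Measure.coe_finsetSum, Measure.coe_smul, Finset.sum_apply, Pi.smul_apply,
        smul_eq_mul]
      refine Finset.sum_eq_zero fun i _ => ?_
      by_cases hi : p.2 i = 0
      · simp [hi]
      · refine mul_eq_zero_of_right _ ?_
        rw [Measure.dirac_apply, Set.indicator_of_notMem]
        simp only [Set.mem_ofPred_eq, not_not]
        refine lt_of_lt_of_le (pos_iff_ne_zero.2 hi) ?_
        refine le_trans ?_ (Finset.single_le_sum (f := fun j => p.2 j * Measure.dirac (z j) {z i})
          (fun _ _ => zero_le) (Finset.mem_univ i))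
        simp
    filter_upwards [h1, hx'] with y h1 h2
    rwa [h2]

omit [StandardBorelSpace Ω] in
lemma exists_fin_valued_of_ae_mem_finite [Nonempty Ω] {E : Type*} [MeasurableSpace E]
    [MeasurableSingletonClass E] {f : Ω → E} (hf : Measurable[m] f) {F : Set E} (hF : F.Finite)
    (h : ∀ᵐ x ∂μ, f x ∈ F) :
    ∃ (r : ℕ) (Y : Ω → Fin r) (g : Fin r → E), Measurable[m] Y ∧ ∀ᵐ x ∂μ, f x = g (Y x) := by
  classical
  obtain ⟨x₀, hx₀⟩ := h.exists
  have := hF.to_subtype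
  obtain ⟨r, ⟨e⟩⟩ := Finite.exists_equiv_fin F
  let c : E → Fin r := fun t => if ht : t ∈ F then e ⟨t, ht⟩ else e ⟨f x₀, hx₀⟩
  have hc : Measurable c := by
    refine Measurable.dite (s := F) (measurable_of_countable _) measurable_const ?_
    exact hF.measurableSet
  refine ⟨r, fun x => c (f x), fun i => (e.symm i : E), hc.comp hf, ?_⟩
  filter_upwards [h] with x hx
  simp [c, hx]

/-- Every value is a subset sum of one of finitely many weight vectors. The events may vary with the
point, which `exists_label` needs. -/
lemma exists_finite_condExpKernel_apply_mem {ι : Type*} [Fintype ι] (h : FiniteTypeAt m μ)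
    (β : Ω → ι → Set Ω) :
    ∃ F : Set (ι → ℝ≥0∞), F.Finite ∧ ∀ᵐ x ∂μ, (fun i => condExpKernel μ m x (β x i)) ∈ F := by
  classical
  obtain ⟨V, hVf, hV⟩ := h
  refine ⟨⋃ p ∈ V, Set.range fun (I : ι → Finset (Fin p.1)) i => ∑ j ∈ I i, p.2 j,
    hVf.biUnion fun p _ => Set.finite_range _, ?_⟩
  filter_upwards [hV] with x hx
  obtain ⟨p, hpV, z, -, hp⟩ := hx
  simp only [Set.mem_iUnion]
  refine ⟨p, hpV, fun i => Finset.univ.filter fun j => z j ∈ β x i, ?_⟩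
  funext i
  rw [hp]
  simp [Measure.coe_finsetSum, Finset.sum_apply, Finset.sum_filter, Measure.dirac_apply,
    Set.indicator_apply]

/-- The conditional probabilities of finitely many events factor through a finite-valued map. -/
lemma exists_fin_valued_condExpKernel [Nonempty Ω] {ι : Type*} [Fintype ι]
    (h : FiniteTypeAt m μ) {B : ι → Set Ω} (hB : ∀ i, MeasurableSet (B i)) :
    ∃ (r : ℕ) (Y : Ω → Fin r) (g : ι → Fin r → ℝ≥0∞), Measurable[m] Y ∧
      ∀ i, ∀ᵐ x ∂μ, condExpKernel μ m x (B i) = g i (Y x) := by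
  obtain ⟨F, hF, hFm⟩ := exists_finite_condExpKernel_apply_mem h fun _ => B
  have hf : Measurable[m] fun x i => condExpKernel μ m x (B i) :=
    @measurable_pi_lambda _ _ _ m _ _ fun i => measurable_condExpKernel (hB i)
  obtain ⟨r, Y, g, hY, hg⟩ := exists_fin_valued_of_ae_mem_finite hf hF hFm
  exact ⟨r, Y, fun i y => g y i, hY, fun i => hg.mono fun x hx => congrFun hx i⟩

/-- A finite-valued label which, together with the conditional measure on the coarser σ-algebra
`m`, determines a given function measurable with respect to the finer σ-algebra `m'`. -/
lemma exists_label [Nonempty Ω] (hmm : m ≤ m') (hm' : m' ≤ mΩ)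
    (h : FiniteTypeAt m μ) {f : Ω → ℝ} (hf : Measurable[m'] f) :
    ∃ (r : ℕ) (L : Ω → Fin r), Measurable[m'] L ∧ ∃ G : Set Ω, (∀ᵐ x ∂μ, x ∈ G) ∧
      ∀ x ∈ G, ∀ y ∈ G, condExpKernel μ m x = condExpKernel μ m y → L x = L y → f x = f y := by
  have hm : m ≤ mΩ := hmm.trans hm'
  have hfΩ : Measurable f := hf.mono hm' le_rfl
  -- The label is the conditional distribution function of `f` at `f x`, a rank of `x` within its
  -- element. Since points have positive mass, it increases strictly with `f`.
  obtain ⟨F, hF, hFm⟩ := exists_finite_condExpKernel_apply_mem (ι := Unit) h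
    fun x _ => {y | f y < f x}
  have hmeas : Measurable[m'] fun x (_ : Unit) => condExpKernel μ m x {y | f y < f x} := by
    have h1 : @Measurable _ _ (@Prod.instMeasurableSpace _ _ m' mΩ) _ (fun z : Ω × Ω => f z.2) :=
      hfΩ.comp (@measurable_snd _ _ m' mΩ)
    have h2 : @Measurable _ _ (@Prod.instMeasurableSpace _ _ m' mΩ) _ (fun z : Ω × Ω => f z.1) :=
      hf.comp (@measurable_fst _ _ m' mΩ)
    have hs := (@Measurable.prodMk _ (@Prod.instMeasurableSpace _ _ m' mΩ) _ _ _ _ _ _ h1 h2)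
      (measurableSet_lt measurable_fst measurable_snd)
    have := @Kernel.measurable_kernel_prodMk_left _ _ m' mΩ
      (@Kernel.comap _ _ m mΩ _ m' (condExpKernel μ m) id (measurable_id'' hmm)) _ _ hs
    exact @measurable_pi_lambda _ _ _ m' _ _ fun _ => this
  obtain ⟨r, L, g, hL, hg⟩ := exists_fin_valued_of_ae_mem_finite hmeas hF hFm
  refine ⟨r, L, hL, _, hg.and (ae_condExpKernel_singleton_pos hm h), ?_⟩
  rintro x ⟨hx, hxp⟩ y ⟨hy, hyp⟩ hxy hLxy
  have key : condExpKernel μ m x {z | f z < f x} = condExpKernel μ m x {z | f z < f y} := by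
    have := congrFun (hx.trans ((congrArg g hLxy).trans hy.symm)) ()
    simpa [hxy] using this
  have aux : ∀ a b : Ω, 0 < condExpKernel μ m x {a} →
      condExpKernel μ m x {z | f z < f a} = condExpKernel μ m x {z | f z < f b} →
      ¬ f a < f b := by
    intro a b ha hab hlt
    have hsub : {z | f z < f a} ∪ {a} ⊆ {z | f z < f b} := by
      rintro z (hz | rfl)
      · exact lt_trans hz hlt
      · exact hlt
    have hdisj : Disjoint {z | f z < f a} {a} := by
      rw [Set.disjoint_singleton_right]; simp
    have h1 := measure_mono (μ := condExpKernel μ m x) hsub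
    rw [measure_union hdisj (measurableSet_singleton a), ← hab] at h1
    have h2 : condExpKernel μ m x {z | f z < f a} < condExpKernel μ m x {z | f z < f a}
        + condExpKernel μ m x {a} :=
      ENNReal.lt_add_right (measure_ne_top _ _) ha.ne'
    exact absurd h1 (not_le.2 h2)
  refine le_antisymm (not_lt.1 (aux y x ?_ key.symm)) (not_lt.1 (aux x y hxp key))
  rw [hxy]; exact hyp

end Kernel

/-! ### Reversed martingale convergence. -/

section Ergodic

variable {Ω : Type*} [mΩ : MeasurableSpace Ω] {μ : Measure Ω} [IsProbabilityMeasure μ]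
  {A : ℕ → MeasurableSpace Ω}

omit [IsProbabilityMeasure μ] in
-- The upper limit of the representatives is unchanged when initial terms are dropped, so it lies in
-- every `A n` exactly, not just modulo null sets.
lemma IsErgodic.measure_eq_zero_or_one (herg : IsErgodic μ A) (hA : Antitone A) {S : Set Ω}
    (hS : ∀ n, ∃ T, MeasurableSet[A n] T ∧ S =ᵐ[μ] T) : μ S = 0 ∨ μ S = 1 := by
  choose T hT hST using hS
  have hae : S =ᵐ[μ] (⋂ n, ⋃ i, T (n + i) : Set Ω) := by
    filter_upwards [ae_all_iff.2 hST] with x hx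
    have hx' : ∀ n, (x ∈ S ↔ x ∈ T n) := fun n => iff_of_eq (hx n)
    refine propext (?_ : x ∈ S ↔ x ∈ (⋂ n, ⋃ i, T (n + i) : Set Ω))
    simp [← hx']
  rw [measure_congr hae]
  refine herg _ fun N => ?_
  have h1 : (⋂ n, ⋃ i, T (n + i) : Set Ω) = ⋂ n, ⋃ i, T (n + N + i) := by
    ext x
    simp only [Set.mem_iInter, Set.mem_iUnion]
    refine ⟨fun h n => h (n + N), fun h n => ?_⟩
    obtain ⟨i, hi⟩ := h n
    exact ⟨N + i, by rwa [← add_assoc]⟩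
  rw [h1]
  refine MeasurableSet.iInter fun n => MeasurableSet.iUnion fun i => ?_
  exact hA (by omega : N ≤ n + N + i) _ (hT _)

/-- Mean square convergence of reversed martingales over an ergodic filtration. -/
lemma exists_tendsto_condExp (hA : Antitone A) (hle : ∀ n, A n ≤ mΩ) (herg : IsErgodic μ A)
    {f : Ω → ℝ} (hf : MemLp f 2 μ) :
    ∃ c : ℝ, Tendsto (fun n => eLpNorm (fun x => (μ[f | A n]) x - c) 2 μ) atTop (𝓝 0) := by
  have hfact : ∀ n, Fact (A n ≤ mΩ) := fun n => ⟨hle n⟩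
  let U : ℕ → Submodule ℝ (Lp ℝ 2 μ) := fun n => lpMeas ℝ ℝ (A n) 2 μ
  have hU : Antitone U := by
    intro i j hij g hg
    rw [mem_lpMeas_iff_aestronglyMeasurable] at hg ⊢
    exact hg.mono (hA hij)
  have hcomp : ∀ n, CompleteSpace (U n) := fun n =>
    inferInstanceAs (CompleteSpace (lpMeas ℝ ℝ (A n) 2 μ))
  -- The subspaces `U n` decrease, so their complements increase and the projections onto the
  -- complements converge strongly.
  have hlim := Submodule.starProjection_tendsto_closure_iSup (fun n => (U n)ᗮ)
    (fun i j hij => Submodule.orthogonal_le (hU hij)) hf.toLp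
  set g : Lp ℝ 2 μ := hf.toLp - (⨆ n, (U n)ᗮ).topologicalClosure.starProjection hf.toLp
  have hlim' : Tendsto (fun n => (U n).starProjection hf.toLp) atTop (𝓝 g) := by
    refine (tendsto_const_nhds.sub hlim).congr fun n => ?_
    rw [Submodule.starProjection_orthogonal_val]
    simp
  have hg : ∀ n, AEStronglyMeasurable[A n] g μ := fun n => by
    refine (isClosed_aestronglyMeasurable (p := 2) (F := ℝ) (μ := μ) (hle n)).mem_of_tendsto hlim' ?_
    filter_upwards [eventually_ge_atTop n] with k hk
    have : (U k).starProjection hf.toLp ∈ U n := hU hk (Submodule.starProjection_apply_mem _ _)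
    exact mem_lpMeas_iff_aestronglyMeasurable.1 this
  obtain ⟨c, hc⟩ : ∃ c : ℝ, (g : Ω → ℝ) =ᵐ[μ] Function.const Ω c := by
    refine exists_eventuallyEq_const_of_forall_separating MeasurableSet fun V hV => ?_
    have h01 : μ (g ⁻¹' V) = 0 ∨ μ (g ⁻¹' V) = 1 := by
      refine herg.measure_eq_zero_or_one hA fun n => ⟨(hg n).mk g ⁻¹' V,
        (hg n).stronglyMeasurable_mk.measurable hV, ?_⟩
      exact (hg n).ae_eq_mk.preimage V
    rcases h01 with h | h
    · exact Or.inr (measure_eq_zero_iff_ae_notMem.1 h)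
    · left
      have hm : MeasurableSet (g ⁻¹' V) := (Lp.stronglyMeasurable g).measurable hV
      exact (prob_compl_eq_zero_iff hm).2 h
  refine ⟨c, ((Lp.tendsto_Lp_iff_tendsto_eLpNorm' _ _).1 hlim').congr fun n => ?_⟩
  refine eLpNorm_congr_ae ?_
  have h1 := hf.condExpL2_ae_eq_condExp (𝕜 := ℝ) (hle n)
  filter_upwards [h1, hc] with x h1 h2
  rw [Pi.sub_apply, h2, ← h1]
  rfl

/-- In an ergodic filtration, conditional probabilities become deterministic in the mean. -/
lemma exists_tendsto_condExpKernel [StandardBorelSpace Ω] (hA : Antitone A)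
    (hle : ∀ n, A n ≤ mΩ) (herg : IsErgodic μ A) {S : Set Ω} (hS : MeasurableSet S) :
    ∃ c : ℝ≥0∞, Tendsto (fun n => ∫⁻ x, ((condExpKernel μ (A n) x S - c) +
      (c - condExpKernel μ (A n) x S)) ∂μ) atTop (𝓝 0) := by
  have hf : MemLp (S.indicator fun _ => (1 : ℝ)) 2 μ := memLp_indicator_const 2 hS 1 (by simp)
  obtain ⟨c, hc⟩ := exists_tendsto_condExp hA hle herg hf
  refine ⟨ENNReal.ofReal c, ?_⟩
  -- The factor 2 comes from bounding each truncated difference separately by the absolute value.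
  have h2 : Tendsto (fun n => 2 * eLpNorm (fun x =>
      (μ[S.indicator fun _ => (1 : ℝ) | A n]) x - c) 2 μ) atTop (𝓝 0) := by
    simpa using ENNReal.Tendsto.const_mul hc (Or.inr (by simp))
  refine tendsto_of_tendsto_of_tendsto_of_le_of_le tendsto_const_nhds h2 (fun n => zero_le) fun n => ?_
  have h3 : eLpNorm (fun x => (μ[S.indicator fun _ => (1 : ℝ) | A n]) x - c) 1 μ ≤
      eLpNorm (fun x => (μ[S.indicator fun _ => (1 : ℝ) | A n]) x - c) 2 μ :=
    eLpNorm_le_eLpNorm_of_exponent_le (by norm_num)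
      (integrable_condExp.sub (integrable_const c)).aestronglyMeasurable
  refine le_trans ?_ (mul_le_mul_right h3 2)
  rw [eLpNorm_one_eq_lintegral_enorm, ← lintegral_const_mul' _ _ (by simp)]
  refine lintegral_mono_ae ?_
  filter_upwards [condExpKernel_ae_eq_condExp (hle n) hS] with x hx
  have hx' : condExpKernel μ (A n) x S =
      ENNReal.ofReal ((μ[S.indicator fun _ => (1 : ℝ) | A n]) x) := by
    rw [← hx, ofReal_measureReal]
  rw [hx', two_mul]
  set a := (μ[S.indicator fun _ => (1 : ℝ) | A n]) x
  rw [Real.enorm_eq_ofReal_abs]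
  have key : ∀ u v : ℝ, ENNReal.ofReal u - ENNReal.ofReal v ≤ ENNReal.ofReal |u - v| := by
    intro u v
    rw [tsub_le_iff_left]
    refine le_trans (ENNReal.ofReal_le_ofReal ?_) ENNReal.ofReal_add_le
    linarith [le_abs_self (u - v)]
  exact add_le_add (key a c) (abs_sub_comm a c ▸ key c a)

end Ergodic

/-! ### Couplings with small disagreement. -/

section Coupling

variable {Ω : Type*} [MeasurableSpace Ω]

lemma exists_measure_map_fst_map_snd (α β : Measure Ω) [IsFiniteMeasure α] [IsFiniteMeasure β]
    (h : α Set.univ = β Set.univ) :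
    ∃ ψ : Measure (Ω × Ω), ψ.map Prod.fst = α ∧ ψ.map Prod.snd = β := by
  by_cases h0 : α Set.univ = 0
  · have hβ : β = 0 := Measure.measure_univ_eq_zero.1 (h ▸ h0)
    exact ⟨0, by simp [Measure.measure_univ_eq_zero.1 h0, hβ]⟩
  · refine ⟨(α Set.univ)⁻¹ • α.prod β, ?_, ?_⟩
    · rw [Measure.map_smul, Measure.map_fst_prod, ← h, smul_smul,
        ENNReal.inv_mul_cancel h0 (measure_ne_top _ _), one_smul]
    · rw [Measure.map_smul, Measure.map_snd_prod, smul_smul,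
        ENNReal.inv_mul_cancel h0 (measure_ne_top _ _), one_smul]

/-- Splitting a measure along a finite partition in prescribed proportions. -/
lemma exists_split {r : ℕ} {Z : Ω → Fin r} (hZ : Measurable Z) (α : Measure Ω)
    [IsFiniteMeasure α] (c : Fin r → ℝ≥0∞) (hc : ∀ z, c z ≤ α (Z ⁻¹' {z})) :
    ∃ (α₁ : Fin r → Measure Ω) (α₂ : Measure Ω), ∑ z, α₁ z + α₂ = α ∧
      (∀ z, α₁ z Set.univ = c z) ∧ (∀ z, α₁ z (Z ⁻¹' {z})ᶜ = 0) ∧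
      α₂ Set.univ = ∑ z, (α (Z ⁻¹' {z}) - c z) := by
  have hmz : ∀ z, MeasurableSet (Z ⁻¹' {z}) := fun z => hZ (measurableSet_singleton z)
  have hcancel : ∀ (z) (t : ℝ≥0∞), t ≤ α (Z ⁻¹' {z}) →
      t / α (Z ⁻¹' {z}) * α (Z ⁻¹' {z}) = t := by
    intro z t ht
    refine ENNReal.div_mul_cancel' (fun h => ?_) (fun h => absurd h (measure_ne_top _ _))
    exact le_antisymm (h ▸ ht) zero_le
  refine ⟨fun z => (c z / α (Z ⁻¹' {z})) • α.restrict (Z ⁻¹' {z}),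
    ∑ z, ((α (Z ⁻¹' {z}) - c z) / α (Z ⁻¹' {z})) • α.restrict (Z ⁻¹' {z}), ?_, ?_, ?_, ?_⟩
  · rw [← Finset.sum_add_distrib]
    ext s hs
    have hterm : ∀ z, ((c z / α (Z ⁻¹' {z})) • α.restrict (Z ⁻¹' {z}) +
        ((α (Z ⁻¹' {z}) - c z) / α (Z ⁻¹' {z})) • α.restrict (Z ⁻¹' {z})) s
        = α (s ∩ Z ⁻¹' {z}) := by
      intro z
      rw [← add_smul, ← ENNReal.add_div, add_tsub_cancel_of_le (hc z), Measure.smul_apply,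
        Measure.restrict_apply hs, smul_eq_mul]
      by_cases h0 : α (Z ⁻¹' {z}) = 0
      · rw [measure_mono_null Set.inter_subset_right h0, mul_zero]
      · rw [ENNReal.div_self h0 (measure_ne_top _ _), one_mul]
    rw [Measure.finsetSum_apply, Finset.sum_congr rfl fun z _ => hterm z,
      ← measure_biUnion_finset]
    · congr 1
      ext x; simp
    · intro i _ j _ hij
      refine Set.disjoint_left.2 fun x hx hx' => hij ?_
      exact hx.2.symm.trans hx'.2
    · exact fun z _ => hs.inter (hmz z)
  · intro z
    simp only [Measure.smul_apply, Measure.restrict_apply_univ, smul_eq_mul]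
    exact hcancel z _ (hc z)
  · intro z
    simp [Measure.restrict_apply (hmz z).compl]
  · simp only [Measure.finsetSum_apply, Measure.smul_apply, Measure.restrict_apply_univ,
      smul_eq_mul]
    exact Finset.sum_congr rfl fun z _ => hcancel z _ tsub_le_self

lemma sum_measure_preimage_singleton_fin {r : ℕ} {Z : Ω → Fin r} (hZ : Measurable Z)
    (α : Measure Ω) [IsProbabilityMeasure α] : ∑ z, α (Z ⁻¹' {z}) = 1 := by
  rw [sum_measure_preimage_singleton _ fun z _ => hZ (measurableSet_singleton z)]
  simp

/-- Two probability measures have a coupling under which a finite-valued map `Z` takes different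
values with probability at most the total variation distance of the laws of `Z`. -/
lemma exists_coupling {r : ℕ} {Z : Ω → Fin r} (hZ : Measurable Z) (α β : Measure Ω)
    [IsProbabilityMeasure α] [IsProbabilityMeasure β] :
    ∃ ψ : Measure (Ω × Ω), ψ.map Prod.fst = α ∧ ψ.map Prod.snd = β ∧
      ψ {z | Z z.1 ≠ Z z.2} ≤ ∑ a, (α (Z ⁻¹' {a}) - β (Z ⁻¹' {a})) := by
  have hmz : ∀ z, MeasurableSet (Z ⁻¹' {z}) := fun z => hZ (measurableSet_singleton z)
  -- The common mass `c z` is coupled inside the level set of `z`; the leftovers have equal total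
  -- mass, which bounds the disagreement, and are coupled arbitrarily.
  let c : Fin r → ℝ≥0∞ := fun z => min (α (Z ⁻¹' {z})) (β (Z ⁻¹' {z}))
  obtain ⟨α₁, α₂, hα, hα₁, hα₁', hα₂⟩ := exists_split hZ α c fun z => min_le_left _ _
  obtain ⟨β₁, β₂, hβ, hβ₁, hβ₁', hβ₂⟩ := exists_split hZ β c fun z => min_le_right _ _
  have hcfin : ∀ z, c z ≠ ∞ := fun z => ((min_le_left _ _).trans_lt (measure_lt_top α _)).ne
  have hmass : α₂ Set.univ = β₂ Set.univ := by
    have e1 : ∑ z, c z + α₂ Set.univ = 1 := by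
      rw [hα₂, ← Finset.sum_add_distrib, ← sum_measure_preimage_singleton_fin hZ α]
      exact Finset.sum_congr rfl fun z _ => add_tsub_cancel_of_le (min_le_left _ _)
    have e2 : ∑ z, c z + β₂ Set.univ = 1 := by
      rw [hβ₂, ← Finset.sum_add_distrib, ← sum_measure_preimage_singleton_fin hZ β]
      exact Finset.sum_congr rfl fun z _ => add_tsub_cancel_of_le (min_le_right _ _)
    exact (ENNReal.add_right_inj (ENNReal.sum_ne_top.2 fun z _ => hcfin z)).1 (e1.trans e2.symm)
  have hfin : ∀ (γ γ₂ : Measure Ω) (γ₁ : Fin r → Measure Ω), IsProbabilityMeasure γ →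
      ∑ z, γ₁ z + γ₂ = γ → IsFiniteMeasure γ₂ := by
    intro γ γ₂ γ₁ _ h
    exact isFiniteMeasure_of_le γ (h ▸ Measure.le_add_left le_rfl)
  have := hfin α α₂ α₁ inferInstance hα
  have := hfin β β₂ β₁ inferInstance hβ
  have h1 : ∀ z, ∃ ψ : Measure (Ω × Ω), ψ.map Prod.fst = α₁ z ∧ ψ.map Prod.snd = β₁ z := by
    intro z
    have : IsFiniteMeasure (α₁ z) := ⟨by rw [hα₁]; exact (hcfin z).lt_top⟩
    have : IsFiniteMeasure (β₁ z) := ⟨by rw [hβ₁]; exact (hcfin z).lt_top⟩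
    exact exists_measure_map_fst_map_snd _ _ ((hα₁ z).trans (hβ₁ z).symm)
  choose ψ₁ hψ₁ hψ₁' using h1
  obtain ⟨ψ₂, hψ₂, hψ₂'⟩ := exists_measure_map_fst_map_snd α₂ β₂ hmass
  refine ⟨∑ z, ψ₁ z + ψ₂, ?_, ?_, ?_⟩
  · rw [Measure.map_add _ _ measurable_fst, Measure.map_finset_sum measurable_fst.aemeasurable,
      hψ₂, ← hα]
    simp_rw [hψ₁]
  · rw [Measure.map_add _ _ measurable_snd, Measure.map_finset_sum measurable_snd.aemeasurable,
      hψ₂', ← hβ]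
    simp_rw [hψ₁']
  · rw [Measure.add_apply, Measure.finsetSum_apply]
    have hz : ∀ z, ψ₁ z {w | Z w.1 ≠ Z w.2} = 0 := by
      intro z
      have e1 : ψ₁ z (Prod.fst ⁻¹' (Z ⁻¹' {z})ᶜ) = 0 := by
        rw [← Measure.map_apply measurable_fst (hmz z).compl, hψ₁, hα₁']
      have e2 : ψ₁ z (Prod.snd ⁻¹' (Z ⁻¹' {z})ᶜ) = 0 := by
        rw [← Measure.map_apply measurable_snd (hmz z).compl, hψ₁', hβ₁']
      refine measure_mono_null (fun w hw => ?_) (measure_union_null e1 e2)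
      by_contra hcon
      simp only [Set.mem_union, Set.mem_preimage, Set.mem_compl_iff, Set.mem_singleton_iff,
        not_or, not_not] at hcon
      exact hw (hcon.1.trans hcon.2.symm)
    rw [Finset.sum_eq_zero fun z _ => hz z, zero_add]
    refine (measure_mono (Set.subset_univ _)).trans ?_
    rw [← Set.preimage_univ (f := Prod.fst), ← Measure.map_apply measurable_fst MeasurableSet.univ,
      hψ₂, hα₂]
    refine Finset.sum_le_sum fun z _ => ?_
    simp only [c]
    rw [tsub_min]

end Coupling

/-! ### Towers and their inductive construction. -/

/-- The whole space followed by a sequence of sets generating the σ-algebra. -/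
def generatingSet (Ω : Type*) [MeasurableSpace Ω] [MeasurableSpace.CountablyGenerated Ω] :
    ℕ → Set Ω
  | 0 => Set.univ
  | i + 1 => MeasurableSpace.natGeneratingSequence Ω i

lemma measurableSet_generatingSet {Ω : Type*} [MeasurableSpace Ω]
    [MeasurableSpace.CountablyGenerated Ω] : ∀ i, MeasurableSet (generatingSet Ω i)
  | 0 => MeasurableSet.univ
  | i + 1 => MeasurableSpace.measurableSet_natGeneratingSequence i

/-- The map `W` separates almost all points with the same conditional measure given `m`. -/
def Separates {Ω F : Type*} (m : MeasurableSpace Ω) [MeasurableSpace Ω] [StandardBorelSpace Ω]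
    (μ : Measure Ω) [IsFiniteMeasure μ] (W : Ω → F) : Prop :=
  ∃ G : Set Ω, (∀ᵐ x ∂μ, x ∈ G) ∧
    ∀ x ∈ G, ∀ y ∈ G, condExpKernel μ m x = condExpKernel μ m y → W x = W y → x = y

/-- The finite-valued map `Y` determines the conditional probabilities given `m` of the first `k`
generating sets, intersected with the level sets of `W`. -/
def Determines {Ω F E : Type*} (m : MeasurableSpace Ω) [MeasurableSpace Ω] [StandardBorelSpace Ω]
    (μ : Measure Ω) [IsFiniteMeasure μ] (k : ℕ) (Y : Ω → E) (W : Ω → F) : Prop :=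
  ∀ w, ∀ i ≤ k, ∃ g : E → ℝ≥0∞, ∀ᵐ x ∂μ,
    condExpKernel μ m x (W ⁻¹' {w} ∩ generatingSet Ω i) = g (Y x)

/-- A subsequence of a filtration together with finite-valued maps `X k`, measurable with respect
to its `k`-th σ-algebra, such that `W k` encodes `X 0, …, X (k - 1)` and the coarsening `Y k` of
`X k` determines the conditional law of `W k` and is almost independent of the next σ-algebra. -/
structure Tower {Ω : Type*} [MeasurableSpace Ω] [StandardBorelSpace Ω] (μ : Measure Ω)
    [IsFiniteMeasure μ] (A : ℕ → MeasurableSpace Ω) where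
  n : ℕ → ℕ
  s : ℕ → ℕ
  r : ℕ → ℕ
  q : ℕ → ℕ
  X : ∀ k, Ω → Fin (s k)
  Y : ∀ k, Ω → Fin (r k)
  W : ∀ k, Ω → Fin (q k)
  n_zero : n 0 = 0
  n_strictMono : StrictMono n
  measurable_X : ∀ k, Measurable[A (n k)] (X k)
  factor_Y : ∀ k, ∃ u : Fin (s k) → Fin (r k), ∀ x, Y k x = u (X k x)
  W_zero : ∀ x y, W 0 x = W 0 y
  W_succ : ∀ k, ∃ (p : Fin (q (k + 1)) → Fin (q k)) (t : Fin (q (k + 1)) → Fin (s k))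
    (j : Fin (q k) → Fin (s k) → Fin (q (k + 1))), (∀ x, W k x = p (W (k + 1) x)) ∧
      (∀ x, X k x = t (W (k + 1) x)) ∧ ∀ x, W (k + 1) x = j (W k x) (X k x)
  measurable_W : ∀ k, Measurable (W k)
  separates : ∀ k, Separates (A (n k)) μ (W k)
  determines : ∀ k, Determines (A (n k)) μ k (Y k) (W k)
  mixing : ∀ k, ∃ c : Fin (r k) → ℝ≥0∞,
    ∑ a, ∫⁻ x, ((condExpKernel μ (A (n (k + 1))) x (Y k ⁻¹' {a}) - c a) +
      (c a - condExpKernel μ (A (n (k + 1))) x (Y k ⁻¹' {a}))) ∂μ ≤ (2⁻¹) ^ k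

/-- The data at one level of the construction of a tower. -/
structure Stage (Ω : Type*) where
  n : ℕ
  r : ℕ
  q : ℕ
  Y : Ω → Fin r
  W : Ω → Fin q

/-- The invariant of the construction of a tower. -/
structure Stage.Valid {Ω : Type*} [MeasurableSpace Ω] [StandardBorelSpace Ω] (μ : Measure Ω)
    [IsFiniteMeasure μ] (A : ℕ → MeasurableSpace Ω) (k : ℕ) (S : Stage Ω) : Prop where
  measurable_Y : Measurable[A S.n] S.Y
  measurable_W : Measurable S.W
  separates : Separates (A S.n) μ S.W
  determines : Determines (A S.n) μ k S.Y S.W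

/-- The relation between two consecutive levels of a tower. -/
structure Stage.Next {Ω : Type*} [MeasurableSpace Ω] [StandardBorelSpace Ω] (μ : Measure Ω)
    [IsFiniteMeasure μ] (A : ℕ → MeasurableSpace Ω) (k : ℕ) (S S' : Stage Ω) {s : ℕ}
    (X : Ω → Fin s) : Prop where
  lt : S.n < S'.n
  measurable_X : Measurable[A S.n] X
  factor_Y : ∃ u : Fin s → Fin S.r, ∀ x, S.Y x = u (X x)
  W_succ : ∃ (p : Fin S'.q → Fin S.q) (t : Fin S'.q → Fin s) (j : Fin S.q → Fin s → Fin S'.q),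
    (∀ x, S.W x = p (S'.W x)) ∧ (∀ x, X x = t (S'.W x)) ∧ ∀ x, S'.W x = j (S.W x) (X x)
  mixing : ∃ c : Fin S.r → ℝ≥0∞,
    ∑ a, ∫⁻ x, ((condExpKernel μ (A S'.n) x (S.Y ⁻¹' {a}) - c a) +
      (c a - condExpKernel μ (A S'.n) x (S.Y ⁻¹' {a}))) ∂μ ≤ (2⁻¹) ^ k

section Construction

variable {Ω : Type*} {m : MeasurableSpace Ω} [mΩ : MeasurableSpace Ω] [StandardBorelSpace Ω] {μ : Measure Ω}
  [IsProbabilityMeasure μ] {A : ℕ → MeasurableSpace Ω}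

lemma exists_valid_stage [Nonempty Ω] (hfin : IsFiniteType μ A) (k n : ℕ) {q : ℕ} {W : Ω → Fin q}
    (hW : Measurable W) (hsep : Separates (A n) μ W) :
    ∃ (r : ℕ) (Y : Ω → Fin r), Stage.Valid μ A k ⟨n, r, q, Y, W⟩ := by
  obtain ⟨r, Y, g, hY, hg⟩ := exists_fin_valued_condExpKernel (m := A n) (μ := μ)
    (ι := Fin q × Fin (k + 1)) (hfin n) (B := fun p => W ⁻¹' {p.1} ∩ generatingSet Ω p.2)
    fun p => (hW (measurableSet_singleton _)).inter (measurableSet_generatingSet _)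
  exact ⟨r, Y, hY, hW, hsep, fun w i hi =>
    ⟨g (w, ⟨i, Nat.lt_succ_of_le hi⟩), hg (w, ⟨i, Nat.lt_succ_of_le hi⟩)⟩⟩

/-- Conditional measures given the full σ-algebra are point masses and already separate points. This
starts the induction with a constant `W 0`. -/
lemma separates_of_eq {F : Type*} (hm : m = mΩ) (W : Ω → F) :
    Separates m μ W := by
  have hf : Measurable[m] (embeddingReal Ω) := by
    rw [hm]; exact (measurableEmbedding_embeddingReal Ω).measurable
  refine ⟨_, ae_condExpKernel_eq_self (μ := μ) hm.le hf, fun x hx y hy hxy _ => ?_⟩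
  have hx' : ∀ᵐ z ∂(condExpKernel μ m x), embeddingReal Ω z = embeddingReal Ω x := hx
  have hy' : ∀ᵐ z ∂(condExpKernel μ m y), embeddingReal Ω z = embeddingReal Ω y := hy
  rw [← hxy] at hy'
  obtain ⟨z, hz1, hz2⟩ := (hx'.and hy').exists
  exact (measurableEmbedding_embeddingReal Ω).injective (hz1.symm.trans hz2)

lemma Stage.Valid.exists_next [Nonempty Ω] (hA : Antitone A) (hA0 : A 0 = mΩ)
    (hfin : IsFiniteType μ A) (herg : IsErgodic μ A) {k : ℕ} {S : Stage Ω}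
    (hS : S.Valid μ A k) :
    ∃ (S' : Stage Ω) (s : ℕ) (X : Ω → Fin s), S'.Valid μ A (k + 1) ∧ S.Next μ A k S' X := by
  have hle : ∀ n, A n ≤ mΩ := fun n => hA0 ▸ hA (Nat.zero_le n)
  have hYm : ∀ a, MeasurableSet (S.Y ⁻¹' {a}) := fun a =>
    hle _ _ (hS.measurable_Y (measurableSet_singleton a))
  choose c hc using fun a => exists_tendsto_condExpKernel hA hle herg (hYm a)
  have hsum := tendsto_finsetSum Finset.univ fun a _ => hc a
  simp only [Finset.sum_const_zero] at hsum
  -- The next level depends only on `S.Y`; the label `L`, and so `X`, can be defined only after it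
  -- is known.
  obtain ⟨n', hn', hlt⟩ := ((hsum.eventually_le_const
    (ENNReal.pow_pos (ENNReal.inv_pos.2 (by simp : (2 : ℝ≥0∞) ≠ ∞)) k)).and (eventually_gt_atTop S.n)).exists
  obtain ⟨f, hf, hff⟩ := exists_code (m := A S.n) (μ := μ)
  obtain ⟨l, L, hL, G, hG, hGL⟩ := exists_label (hA hlt.le) (hle _) (hfin n') hf
  let X : Ω → Fin (S.r * l) := fun x => finProdFinEquiv (S.Y x, L x)
  have hX : Measurable[A S.n] X :=
    (measurable_of_countable finProdFinEquiv).comp (hS.measurable_Y.prodMk hL)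
  let W' : Ω → Fin (S.q * (S.r * l)) := fun x => finProdFinEquiv (S.W x, X x)
  have hW' : Measurable W' := (measurable_of_countable finProdFinEquiv).comp
    (hS.measurable_W.prodMk (hX.mono (hle _) le_rfl))
  obtain ⟨H, hH, hHs⟩ := hS.separates
  have hsep : Separates (A n') μ W' := by
    refine ⟨G ∩ H, hG.and hH, fun x hx y hy hxy hW => ?_⟩
    have h1 : S.W x = S.W y ∧ X x = X y := by simpa [W'] using hW
    have h2 : S.Y x = S.Y y ∧ L x = L y := by simpa [X] using h1.2
    -- Equal labels inside an element at level `n'` force equal conditional measures at level `S.n`,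
    -- where `S.W` already separates.
    exact hHs x hx.2 y hy.2 (hff _ _ (hGL x hx.1 y hy.1 hxy h2.2)) h1.1
  obtain ⟨r', Y', hV⟩ := exists_valid_stage hfin (k + 1) n' hW' hsep
  refine ⟨_, _, X, hV, hlt, hX, ⟨fun a => (finProdFinEquiv.symm a).1, fun x => by simp [X]⟩,
    ⟨fun w => (finProdFinEquiv.symm w).1, fun w => (finProdFinEquiv.symm w).2,
      fun w a => finProdFinEquiv (w, a), fun x => by simp [W'], fun x => by simp [W'],
      fun x => rfl⟩, c, hn'⟩

theorem exists_tower (hA : Antitone A) (hA0 : A 0 = mΩ) (hfin : IsFiniteType μ A)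
    (herg : IsErgodic μ A) : Nonempty (Tower μ A) := by
  have : Nonempty Ω := nonempty_of_isProbabilityMeasure μ
  obtain ⟨r, Y, h0⟩ := exists_valid_stage (W := fun _ : Ω => (0 : Fin 1)) hfin 0 0
    measurable_const (separates_of_eq hA0 _)
  choose! F s X hF hN using fun k S (hS : Stage.Valid μ A k S) =>
    hS.exists_next hA hA0 hfin herg
  let f : ∀ k, {S : Stage Ω // S.Valid μ A k} := fun k =>
    Nat.rec ⟨_, h0⟩ (fun k S => ⟨F k S.1, hF k S.1 S.2⟩) k
  have hf : ∀ k, (f k).1.Next μ A k (f (k + 1)).1 (X k (f k).1 (f k).2) := fun k => hN k (f k).1 (f k).2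
  exact ⟨{
    n := fun k => (f k).1.n
    s := fun k => s k (f k).1
    r := fun k => (f k).1.r
    q := fun k => (f k).1.q
    X := fun k => X k (f k).1 (f k).2
    Y := fun k => (f k).1.Y
    W := fun k => (f k).1.W
    n_zero := rfl
    n_strictMono := strictMono_nat_of_lt_succ fun k => (hf k).lt
    measurable_X := fun k => (hf k).measurable_X
    factor_Y := fun k => (hf k).factor_Y
    W_zero := fun _ _ => rfl
    W_succ := fun k => (hf k).W_succ
    measurable_W := fun k => (f k).2.measurable_W
    separates := fun k => (f k).2.separates
    determines := fun k => (f k).2.determines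
    mixing := fun k => (hf k).mixing }⟩

end Construction

/-! ### Conditional expectations under a change of σ-algebra. -/

section CondExp

variable {Ω : Type*} {m m' : MeasurableSpace Ω} [mΩ : MeasurableSpace Ω] {μ : Measure Ω}
  [IsFiniteMeasure μ]

/-- Conditional expectations with respect to σ-algebras which coincide modulo null sets agree. -/
lemma condExp_ae_eq_of_eventuallyMeasurable (hmm : m ≤ m') (hm' : m' ≤ mΩ)
    (h : ∀ S, MeasurableSet[m'] S → ∃ T, MeasurableSet[m] T ∧ S =ᵐ[μ] T) {f : Ω → ℝ}
    (hf : Integrable f μ) : μ[f | m] =ᵐ[μ] μ[f | m'] := by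
  refine ae_eq_condExp_of_forall_setIntegral_eq hm' hf
    (fun _ _ _ => integrable_condExp.integrableOn) (fun S hS _ => ?_)
    (stronglyMeasurable_condExp.mono hmm).aestronglyMeasurable
  obtain ⟨T, hT, hST⟩ := h S hS
  rw [setIntegral_congr_set hST, setIntegral_condExp (hmm.trans hm') hf hT,
    setIntegral_congr_set hST]

lemma condExp_ae_eq_of_condExp_ae_eq (hmm : m ≤ m') (hm' : m' ≤ mΩ) {f g : Ω → ℝ}
    (hfg : μ[f | m'] =ᵐ[μ] g) (hg : StronglyMeasurable[m] g) : μ[f | m] =ᵐ[μ] g := by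
  have hgi : Integrable g μ := (integrable_congr hfg).1 integrable_condExp
  refine (condExp_condExp_of_le hmm hm').symm.trans ((condExp_congr_ae hfg).trans ?_)
  rw [condExp_of_stronglyMeasurable (hmm.trans hm') hg hgi]

end CondExp

section Tail

variable {Ω : Type*} {s : ℕ → ℕ} (X : ∀ n, Ω → Fin (s n))

lemma measurable_tailSigma {k i : ℕ} (h : k ≤ i) : Measurable[tailSigma X k] (X i) := by
  rw [measurable_iff_comap_le]
  exact le_iSup₂_of_le i h le_rfl

lemma tailSigma_le {k : ℕ} {m : MeasurableSpace Ω} (h : ∀ i ≥ k, Measurable[m] (X i)) :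
    tailSigma X k ≤ m :=
  iSup₂_le fun i hi => measurable_iff_comap_le.1 (h i hi)

end Tail

/-! ### The chain of a tower: generation, Markov property, ergodicity. -/

namespace Tower

variable {Ω : Type*} [mΩ : MeasurableSpace Ω] [StandardBorelSpace Ω] {μ : Measure Ω}
  [IsProbabilityMeasure μ] {A : ℕ → MeasurableSpace Ω} (T : Tower μ A)

lemma tailSigma_le (hA : Antitone A) (k : ℕ) : tailSigma T.X k ≤ A (T.n k) :=
  DecFiltration.tailSigma_le _ fun i hi =>
    (T.measurable_X i).mono (hA (T.n_strictMono.monotone hi)) le_rfl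

lemma measurable_Y_tailSigma {k i : ℕ} (h : k ≤ i) : Measurable[tailSigma T.X k] (T.Y i) := by
  obtain ⟨u, hu⟩ := T.factor_Y i
  rw [funext hu]
  exact (measurable_of_countable u).comp (measurable_tailSigma _ h)

lemma measurable_W_tailSigma (k : ℕ) : Measurable[tailSigma T.X 0] (T.W k) := by
  induction k with
  | zero =>
    have : Nonempty Ω := nonempty_of_isProbabilityMeasure μ
    have h : T.W 0 = fun _ => T.W 0 (Classical.arbitrary Ω) := funext fun x => T.W_zero _ _
    rw [h]
    exact measurable_const
  | succ k ih =>
    obtain ⟨p, t, j, -, -, hj⟩ := T.W_succ k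
    rw [funext hj]
    exact (measurable_of_countable fun z : Fin (T.q k) × Fin (T.s k) => j z.1 z.2).comp
      (ih.prodMk (measurable_tailSigma _ (Nat.zero_le k)))

lemma exists_X_eq_of_lt {i k : ℕ} (h : i < k) : ∃ t : Fin (T.q k) → Fin (T.s i),
    ∀ x, T.X i x = t (T.W k x) := by
  induction k, h using Nat.le_induction with
  | base =>
    obtain ⟨p, t, j, -, ht, -⟩ := T.W_succ i
    exact ⟨t, ht⟩
  | succ k _ ih =>
    obtain ⟨t, ht⟩ := ih
    obtain ⟨p, _, j, hp, -, -⟩ := T.W_succ k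
    exact ⟨t ∘ p, fun x => by rw [ht, hp]; rfl⟩

lemma exists_condExpKernel_W_eq (k : ℕ) (w : Fin (T.q k)) : ∃ g : Fin (T.r k) → ℝ≥0∞,
    ∀ᵐ x ∂μ, condExpKernel μ (A (T.n k)) x (T.W k ⁻¹' {w}) = g (T.Y k x) := by
  -- Generating set number 0 is the whole space.
  simpa [generatingSet] using T.determines k w 0 (Nat.zero_le k)

lemma exists_condExpKernel_X_eq (k : ℕ) (a : Fin (T.s k)) : ∃ g : Fin (T.r (k + 1)) → ℝ≥0∞,
    ∀ᵐ x ∂μ, condExpKernel μ (A (T.n (k + 1))) x (T.X k ⁻¹' {a}) = g (T.Y (k + 1) x) := by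
  classical
  choose g hg using T.exists_condExpKernel_W_eq (k + 1)
  obtain ⟨t, ht⟩ := T.exists_X_eq_of_lt k.lt_succ_self
  refine ⟨fun y => ∑ w with t w = a, g w y, ?_⟩
  filter_upwards [ae_all_iff.2 hg] with x hx
  simp_rw [← hx]
  rw [sum_measure_preimage_singleton _ fun w _ => T.measurable_W _ (measurableSet_singleton w)]
  congr 1
  ext y
  simp [ht]

/-- The tower generates the whole σ-algebra modulo null sets. -/
lemma le_eventuallyMeasurableSpace_tailSigma_zero (hA0 : A 0 = mΩ) (hA : Antitone A)
    (hfin : IsFiniteType μ A) :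
    mΩ ≤ eventuallyMeasurableSpace (tailSigma T.X 0) (ae μ) := by
  have hle : ∀ n, A n ≤ mΩ := fun n => (hA (Nat.zero_le n)).trans hA0.le
  have key : ∀ k, EventuallyMeasurableSet (tailSigma T.X 0) (ae μ) (generatingSet Ω k) := by
    intro k
    choose g hg using fun w => T.determines k w k le_rfl
    have hWY : Measurable[tailSigma T.X 0] fun x => (T.W k x, T.Y k x) :=
      (T.measurable_W_tailSigma k).prodMk (T.measurable_Y_tailSigma (Nat.zero_le k))
    -- Within its element, `x` is almost surely the only point with its value of `W k`, and it has
    -- positive mass. So it lies in the generating set exactly when that set, cut by the level set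
    -- of `W k`, has positive conditional probability.
    refine ⟨_, hWY (MeasurableSet.of_discrete (s := {z | 0 < g z.1 z.2})), ?_⟩
    obtain ⟨G, hG, hGs⟩ := T.separates k
    filter_upwards [ae_all_iff.2 hg, hG, ae_ae_condExpKernel (hle (T.n k)) hG,
      ae_condExpKernel_eq_condExpKernel (μ := μ) (hle (T.n k)),
      ae_condExpKernel_singleton_pos (hle (T.n k)) (hfin (T.n k))] with x h1 h2 h3 h4 h5
    refine propext (?_ : x ∈ generatingSet Ω k ↔ 0 < g (T.W k x) (T.Y k x))
    rw [← h1]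
    constructor
    · intro hx
      exact h5.trans_le (measure_mono (Set.singleton_subset_iff.2 ⟨rfl, hx⟩))
    · intro hpos
      obtain ⟨y, ⟨hy1, hy2⟩, hy3, hy4⟩ :
          ∃ y ∈ T.W k ⁻¹' {T.W k x} ∩ generatingSet Ω k, y ∈ G ∧
            condExpKernel μ (A (T.n k)) y = condExpKernel μ (A (T.n k)) x := by
        by_contra! hcon
        refine hpos.ne' (measure_mono_null (fun y hy => ?_) (ae_iff.1 (h3.and h4)))
        exact fun h => hcon y hy h.1 h.2
      rwa [← hGs y hy3 x h2 hy4 hy1]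
  refine (MeasurableSpace.generateFrom_natGeneratingSequence Ω).symm.le.trans
    (MeasurableSpace.generateFrom_le ?_)
  rintro _ ⟨i, rfl⟩
  exact key (i + 1)

/-- The sets `{W k = w} ∩ D`, with `D` in the tail from `k`, form a π-system (up to the empty set)
generating the σ-algebra of the chain. On them the conditional probability is the indicator of `D`
times a function of `Y k`. -/
lemma eventuallyMeasurable_condExpKernel (hA0 : A 0 = mΩ) (hA : Antitone A)
    (hfin : IsFiniteType μ A) (k : ℕ) {B : Set Ω} (hB : MeasurableSet B) :
    EventuallyMeasurable (tailSigma T.X k) (ae μ)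
      fun x => condExpKernel μ (A (T.n k)) x B := by
  have hle : ∀ n, A n ≤ mΩ := fun n => (hA (Nat.zero_le n)).trans hA0.le
  let Q : Set (Set Ω) := {S | ∃ w D, MeasurableSet[tailSigma T.X k] D ∧ S = T.W k ⁻¹' {w} ∩ D}
  have hQm : ∀ S ∈ Q, MeasurableSet S := by
    rintro _ ⟨w, D, hD, rfl⟩
    exact (T.measurable_W k (measurableSet_singleton w)).inter (hle _ _ (T.tailSigma_le hA k _ hD))
  have hQ : IsPiSystem Q := by
    rintro _ ⟨w, D, hD, rfl⟩ _ ⟨w', D', hD', rfl⟩ ⟨x, hx⟩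
    have hww : w = w' := hx.1.1.symm.trans hx.2.1
    subst hww
    refine ⟨w, D ∩ D', MeasurableSet.inter hD hD', ?_⟩
    rw [Set.inter_inter_inter_comm, Set.inter_self]
  have hWQ : Measurable[MeasurableSpace.generateFrom Q] (T.W k) := by
    refine @measurable_to_countable' _ _ _ _ (_) _ fun w => ?_
    exact MeasurableSpace.measurableSet_generateFrom ⟨w, Set.univ, MeasurableSet.univ, by simp⟩
  have htail : tailSigma T.X k ≤ MeasurableSpace.generateFrom Q := by
    intro D hD
    have : D = ⋃ w, T.W k ⁻¹' {w} ∩ D := by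
      ext x; simp
    rw [this]
    exact MeasurableSet.iUnion fun w =>
      MeasurableSpace.measurableSet_generateFrom ⟨w, D, hD, rfl⟩
  have h0 : tailSigma T.X 0 ≤ MeasurableSpace.generateFrom Q := by
    refine DecFiltration.tailSigma_le _ fun i _ => ?_
    rcases lt_or_ge i k with h | h
    · obtain ⟨t, ht⟩ := T.exists_X_eq_of_lt h
      rw [funext ht]
      exact (measurable_of_countable t).comp hWQ
    · exact (measurable_tailSigma T.X h).mono htail le_rfl
  have hQle : MeasurableSpace.generateFrom Q ≤ mΩ := MeasurableSpace.generateFrom_le hQm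
  have main : ∀ B, MeasurableSet[MeasurableSpace.generateFrom Q] B →
      EventuallyMeasurable (tailSigma T.X k) (ae μ)
        fun x => condExpKernel μ (A (T.n k)) x B := by
    intro B hB
    induction B, hB using MeasurableSpace.induction_on_inter (h_eq := rfl) (h_inter := hQ) with
    | empty => simp only [measure_empty]; exact measurable_const
    | basic S hS =>
      obtain ⟨w, D, hD, rfl⟩ := hS
      obtain ⟨g, hg⟩ := T.exists_condExpKernel_W_eq k w
      have h1 : Measurable[tailSigma T.X k] (D.indicator fun x => g (T.Y k x)) :=
        ((measurable_of_countable g).comp (T.measurable_Y_tailSigma le_rfl)).indicator hD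
      refine h1.eventuallyMeasurable_of_eventuallyEq ?_
      have hmem : Measurable[A (T.n k)] fun x => x ∈ D :=
        (@measurable_mem Ω D (A (T.n k))).2 (T.tailSigma_le hA k _ hD)
      filter_upwards [hg, ae_condExpKernel_eq_self (μ := μ) (hle (T.n k)) hmem] with x h2 h3
      by_cases hx : x ∈ D
      · rw [Set.indicator_of_mem hx, ← h2]
        refine measure_congr ?_
        filter_upwards [h3] with y hy
        refine propext (?_ : y ∈ T.W k ⁻¹' {w} ∩ D ↔ y ∈ T.W k ⁻¹' {w})
        exact ⟨fun h => h.1, fun h => ⟨h, hy.mpr hx⟩⟩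
      · rw [Set.indicator_of_notMem hx]
        refine measure_mono_null (fun y hy => ?_) (ae_iff.1 h3)
        exact fun h => hx (h.mp hy.2)
    | compl S hS ih =>
      have : ∀ x, condExpKernel μ (A (T.n k)) x Sᶜ = 1 - condExpKernel μ (A (T.n k)) x S :=
        fun x => prob_compl_eq_one_sub (hQle _ hS)
      simp_rw [this]
      exact Measurable.const_sub ih 1
    | iUnion f hd hf ih =>
      have : ∀ x, condExpKernel μ (A (T.n k)) x (⋃ i, f i) =
          ∑' i, condExpKernel μ (A (T.n k)) x (f i) :=
        fun x => measure_iUnion hd fun i => hQle _ (hf i)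
      simp_rw [this]
      have hsum : Measurable fun u : ℕ → ℝ≥0∞ => ∑' i, u i :=
        Measurable.tsum fun i => measurable_pi_apply i
      exact hsum.comp (@measurable_pi_lambda _ _ _
        (eventuallyMeasurableSpace (tailSigma T.X k) (ae μ)) _ _ ih)
  obtain ⟨B', hB', hBB'⟩ := T.le_eventuallyMeasurableSpace_tailSigma_zero hA0 hA hfin _ hB
  refine EventuallyMeasurable.congr (main B' (h0 _ hB')) ?_
  filter_upwards [ae_ae_condExpKernel (hle (T.n k)) hBB'] with x hx
  exact measure_congr hx

/-- Modulo null sets, `B` is the event that its own conditional probability equals 1. -/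
lemma exists_measurableSet_tailSigma_ae_eq (hA0 : A 0 = mΩ) (hA : Antitone A)
    (hfin : IsFiniteType μ A) (k : ℕ) {B : Set Ω} (hB : MeasurableSet[A (T.n k)] B) :
    ∃ D, MeasurableSet[tailSigma T.X k] D ∧ B =ᵐ[μ] D := by
  have hle : A (T.n k) ≤ mΩ := (hA (Nat.zero_le _)).trans hA0.le
  have h1 : EventuallyMeasurableSet (tailSigma T.X k) (ae μ)
      ((fun x => condExpKernel μ (A (T.n k)) x B) ⁻¹' {1}) :=
    T.eventuallyMeasurable_condExpKernel hA0 hA hfin k (hle _ hB) (measurableSet_singleton 1)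
  refine h1.congr ?_
  filter_upwards [condExpKernel_apply_eq_indicator (μ := μ) hle hB] with x hx
  refine propext (?_ : x ∈ B ↔ condExpKernel μ (A (T.n k)) x B = 1)
  rw [hx]
  by_cases h : x ∈ B <;> simp [h]

lemma eventuallyMeasurableSpace_eq (hA0 : A 0 = mΩ) (hA : Antitone A)
    (hfin : IsFiniteType μ A) (k : ℕ) :
    eventuallyMeasurableSpace (A (T.n k)) (ae μ) =
      eventuallyMeasurableSpace (tailSigma T.X k) (ae μ) := by
  refine le_antisymm ?_ ?_
  · rintro S ⟨B, hB, hSB⟩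
    obtain ⟨D, hD, hBD⟩ := T.exists_measurableSet_tailSigma_ae_eq hA0 hA hfin k hB
    exact ⟨D, hD, hSB.trans hBD⟩
  · rintro S ⟨B, hB, hSB⟩
    exact ⟨B, T.tailSigma_le hA k _ hB, hSB⟩

lemma condExpKernel_tailSigma_ae_eq (hA0 : A 0 = mΩ) (hA : Antitone A)
    (hfin : IsFiniteType μ A) (k : ℕ) {B : Set Ω} (hB : MeasurableSet B) :
    ∀ᵐ x ∂μ, condExpKernel μ (tailSigma T.X k) x B = condExpKernel μ (A (T.n k)) x B := by
  have hle : A (T.n k) ≤ mΩ := (hA (Nat.zero_le _)).trans hA0.le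
  have hle' := T.tailSigma_le hA k
  have h := condExp_ae_eq_of_eventuallyMeasurable hle' hle
    (fun S hS => T.exists_measurableSet_tailSigma_ae_eq hA0 hA hfin k hS)
    ((integrable_const (1 : ℝ)).indicator hB)
  filter_upwards [h, condExpKernel_ae_eq_condExp hle hB,
    condExpKernel_ae_eq_condExp (hle'.trans hle) hB] with x h1 h2 h3
  rw [← measureReal_eq_measureReal_iff, h2, h3, h1]

/-- The conditional law of `X k` given the larger σ-algebra `A (n (k + 1))` is a function of `X (k +
1)`, so conditioning on the tail or on `X (k + 1)` alone gives the same function. -/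
lemma isMarkovChain (hA0 : A 0 = mΩ) (hA : Antitone A) : IsMarkovChain μ T.X where
  measurable k := (T.measurable_X k).mono ((hA (Nat.zero_le _)).trans hA0.le) le_rfl
  markov k a := by
    have hle : ∀ n, A n ≤ mΩ := fun n => (hA (Nat.zero_le n)).trans hA0.le
    have hm : MeasurableSet (T.X k ⁻¹' {a}) := hle _ _ (T.measurable_X k (measurableSet_singleton a))
    obtain ⟨g, hg⟩ := T.exists_condExpKernel_X_eq k a
    obtain ⟨u, hu⟩ := T.factor_Y (k + 1)
    have h1 : μ⟦T.X k ⁻¹' {a} | A (T.n (k + 1))⟧ =ᵐ[μ]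
        fun x => (g (u (T.X (k + 1) x))).toReal := by
      filter_upwards [hg, condExpKernel_ae_eq_condExp (μ := μ) (hle (T.n (k + 1))) hm] with x h1 h2
      rw [← h2, measureReal_def, h1, hu]
    have h2 : Measurable fun z => (g (u z)).toReal := measurable_of_countable _
    refine (condExp_ae_eq_of_condExp_ae_eq (T.tailSigma_le hA _) (hle _) h1
      (h2.comp (measurable_tailSigma _ le_rfl)).stronglyMeasurable).trans ?_
    exact (condExp_ae_eq_of_condExp_ae_eq (T.measurable_X _).comap_le (hle _) h1
      (h2.comp (comap_measurable _)).stronglyMeasurable).symm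

lemma isErgodic (hA : Antitone A) (herg : IsErgodic μ A) : IsErgodic μ (tailSigma T.X) :=
  fun S hS => herg S fun k => hA (T.n_strictMono.le_apply) _ (T.tailSigma_le hA k _ (hS k))

end Tower

/-! ### An almost cylinder metric on the path space. -/

section PathSpace

variable {s : ℕ → ℕ}

/-- The standard ultrametric on the path space. -/
noncomputable def pathDist (x y : ∀ n, Fin (s n)) : ℝ := @dist _ PiNat.dist x y

lemma pathDist_le_one (x y : ∀ n, Fin (s n)) : pathDist x y ≤ 1 := PiNat.dist_le_one x y

lemma pathDist_le_of_forall_lt {x y : ∀ n, Fin (s n)} {k : ℕ} (h : ∀ i < k, x i = y i) :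
    pathDist x y ≤ (1 / 2) ^ k :=
  PiNat.mem_cylinder_iff_dist_le.1 (PiNat.mem_cylinder_iff.2 h)

lemma isSemimetric_pathDist : IsSemimetric (pathDist (s := s)) where
  nonneg := PiNat.dist_nonneg
  self := PiNat.dist_self
  symm := PiNat.dist_comm
  triangle := PiNat.dist_triangle

/-- The path which follows `x` before time `m` and stays at the initial state afterwards. -/
def truncate (m : ℕ) (x : ∀ n, Fin (s n)) : ∀ n, Fin (s n) :=
  fun n => if n < m then x n else ⟨0, (x n).pos⟩

lemma pathDist_truncate_le (m : ℕ) (x : ∀ n, Fin (s n)) :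
    pathDist x (truncate m x) ≤ (1 / 2) ^ m :=
  pathDist_le_of_forall_lt fun i hi => by simp [truncate, hi]

lemma isAlmostCylinderMetric_pathDist : IsAlmostCylinderMetric (pathDist (s := s)) := by
  refine ⟨isSemimetric_pathDist, PiNat.eq_of_dist_eq_zero,
    fun m x y => pathDist (truncate m x) (truncate m y), fun m => ⟨⟨?_, ?_, ?_, ?_⟩, m, ?_⟩, ?_⟩
  · exact fun x y => isSemimetric_pathDist.nonneg _ _
  · exact fun x => isSemimetric_pathDist.self _
  · exact fun x y => isSemimetric_pathDist.symm _ _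
  · exact fun x y z => isSemimetric_pathDist.triangle _ _ _
  · intro x x' y y' hx hy
    have key : ∀ z z' : ∀ n, Fin (s n), (∀ n < m, z n = z' n) → truncate m z = truncate m z' := by
      intro z z' h
      funext n
      by_cases hn : n < m
      · simp [truncate, hn, h n hn]
      · simp [truncate, hn]
    simp only [key x x' hx, key y y' hy]
  · intro ε hε
    -- Truncating each of the two arguments costs at most `(1 / 2) ^ m`.
    have hlim : Tendsto (fun m : ℕ => 2 * (1 / 2 : ℝ) ^ m) atTop (𝓝 0) := by
      simpa using (tendsto_pow_atTop_nhds_zero_of_lt_one (by norm_num : (0 : ℝ) ≤ 1 / 2)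
        (by norm_num)).const_mul 2
    obtain ⟨M, hM⟩ := eventually_atTop.1 (hlim.eventually_lt_const hε)
    refine ⟨M, fun m hm x y => lt_of_le_of_lt ?_ (hM m hm)⟩
    have h := isSemimetric_pathDist (s := s)
    have h1 := h.triangle (truncate m x) x (truncate m y)
    have h2 := h.triangle x y (truncate m y)
    have h3 := h.triangle x (truncate m x) y
    have h4 := h.triangle (truncate m x) (truncate m y) y
    have h5 := pathDist_truncate_le m x
    have h6 := pathDist_truncate_le m y
    have h7 := h.symm (truncate m x) x
    have h8 := h.symm (truncate m y) y
    rw [abs_le]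
    constructor <;> linarith

end PathSpace

/-! ### Collapse of the iterated transfers. -/

section Kantorovich

variable {Ω : Type*} [MeasurableSpace Ω]

/-- Neither `d` nor `S` has to be measurable, so iterated transfers can be bounded without proving
them measurable. -/
lemma kantorovich_le {α β : Measure Ω} [IsProbabilityMeasure α] {ψ : Measure (Ω × Ω)}
    (hα : ψ.map Prod.fst = α) (hβ : ψ.map Prod.snd = β) {d : Ω → Ω → ℝ≥0∞} {G : Set Ω}
    (hGα : ∀ᵐ x ∂α, x ∈ G) (hGβ : ∀ᵐ x ∂β, x ∈ G) {S : Set (Ω × Ω)} {e : ℝ≥0∞}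
    (hd : ∀ x ∈ G, ∀ y ∈ G, d x y ≤ S.indicator 1 (x, y) + e) :
    kantorovich d α β ≤ ψ S + e := by
  refine iInf₂_le_of_le ψ ⟨hα, hβ⟩ ?_
  have h1 : ∀ᵐ z ∂ψ, z.1 ∈ G := ae_of_ae_map measurable_fst.aemeasurable (hα.symm ▸ hGα)
  have h2 : ∀ᵐ z ∂ψ, z.2 ∈ G := ae_of_ae_map measurable_snd.aemeasurable (hβ.symm ▸ hGβ)
  have huniv : ψ Set.univ = 1 := by
    rw [← Set.preimage_univ (f := Prod.fst), ← Measure.map_apply measurable_fst MeasurableSet.univ,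
      hα, measure_univ]
  calc ∫⁻ z, d z.1 z.2 ∂ψ ≤ ∫⁻ z, (S.indicator 1 z + e) ∂ψ := by
        refine lintegral_mono_ae ?_
        filter_upwards [h1, h2] with z hz1 hz2 using hd _ hz1 _ hz2
    _ = ∫⁻ z, S.indicator 1 z ∂ψ + e := by
        rw [lintegral_add_right _ measurable_const, lintegral_const, huniv, mul_one]
    _ ≤ ψ S + e := by
        gcongr
        exact lintegral_indicator_one_le S

end Kantorovich

namespace Tower

variable {Ω : Type*} [mΩ : MeasurableSpace Ω] [StandardBorelSpace Ω] {μ : Measure Ω}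
  [IsProbabilityMeasure μ] {A : ℕ → MeasurableSpace Ω} (T : Tower μ A)

/-- The iterated transfers of the path metric along the filtration generated by a tower. -/
noncomputable def pathTransfer : ℕ → Ω → Ω → ℝ≥0∞ :=
  iteratedTransfer μ (tailSigma T.X)
    fun x y => ENNReal.ofReal (pathDist (fun k => T.X k x) (fun k => T.X k y))

/-- The pairs of points whose trajectories agree at the times from `j` to `k`, where at time `k`
only the coarser map `Y k` is taken into account. -/
def agree (j k : ℕ) : Set (Ω × Ω) :=
  {z | (∀ i, j ≤ i → i < k → T.X i z.1 = T.X i z.2) ∧ T.Y k z.1 = T.Y k z.2}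

lemma Y_eq_of_mem_agree {j k : ℕ} (hjk : j ≤ k) {z : Ω × Ω} (hz : z ∈ T.agree j k) :
    T.Y j z.1 = T.Y j z.2 := by
  rcases hjk.eq_or_lt with rfl | h
  · exact hz.2
  · obtain ⟨u, hu⟩ := T.factor_Y j
    rw [hu, hu, hz.1 j le_rfl h]

lemma pathTransfer_zero_le (k : ℕ) (x y : Ω) :
    T.pathTransfer 0 x y ≤ (T.agree 0 k)ᶜ.indicator 1 (x, y) + 2⁻¹ ^ k := by
  change ENNReal.ofReal (pathDist _ _) ≤ _
  by_cases h : (x, y) ∈ T.agree 0 k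
  · have h1 := pathDist_le_of_forall_lt (x := fun k => T.X k x) (y := fun k => T.X k y)
      fun i hi => h.1 i (Nat.zero_le i) hi
    refine le_add_left ((ENNReal.ofReal_le_ofReal h1).trans_eq ?_)
    rw [ENNReal.ofReal_pow (by norm_num), one_div, ENNReal.ofReal_inv_of_pos (by norm_num)]
    simp
  · rw [Set.indicator_of_mem (Set.mem_compl h)]
    refine le_add_right ((ENNReal.ofReal_le_ofReal (pathDist_le_one _ _)).trans_eq ?_)
    simp

/-- Up to an error `2⁻¹ ^ k`, the `j`-th transfer is controlled by the states between the times
`j` and `k`. -/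
lemma exists_pathTransfer_le_agree (hA0 : A 0 = mΩ) (hA : Antitone A) (hfin : IsFiniteType μ A)
    {j k : ℕ} (hjk : j ≤ k) : ∃ G : Set Ω, (∀ᵐ x ∂μ, x ∈ G) ∧ ∀ x ∈ G, ∀ y ∈ G,
      T.pathTransfer j x y ≤ (T.agree j k)ᶜ.indicator 1 (x, y) + 2⁻¹ ^ k := by
  have hle : ∀ n, A n ≤ mΩ := fun n => (hA (Nat.zero_le n)).trans hA0.le
  have hle' : ∀ i, tailSigma T.X i ≤ mΩ := fun i => (T.tailSigma_le hA i).trans (hle _)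
  have hX : ∀ i, Measurable (T.X i) := fun i => (T.measurable_X i).mono (hle _) le_rfl
  induction j with
  | zero => exact ⟨Set.univ, by simp, fun x _ y _ => T.pathTransfer_zero_le k x y⟩
  | succ j ih =>
    obtain ⟨G, hG, hGle⟩ := ih (by omega)
    choose g hg using T.exists_condExpKernel_X_eq j
    have hlaw : ∀ᵐ x ∂μ, ∀ a, condExpKernel μ (tailSigma T.X (j + 1)) x (T.X j ⁻¹' {a}) =
        g a (T.Y (j + 1) x) := by
      refine ae_all_iff.2 fun a => ?_
      filter_upwards [hg a, T.condExpKernel_tailSigma_ae_eq hA0 hA hfin (j + 1)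
        (hX j (measurableSet_singleton a))] with x h1 h2
      rw [h2, h1]
    have hconst : ∀ᵐ x ∂μ, ∀ i, j + 1 ≤ i →
        ∀ᵐ z ∂(condExpKernel μ (tailSigma T.X (j + 1)) x), T.X i z = T.X i x := by
      refine ae_all_iff.2 fun i => ?_
      by_cases hi : j + 1 ≤ i
      · filter_upwards [ae_condExpKernel_eq_self (μ := μ) (hle' (j + 1))
          (measurable_tailSigma T.X hi)] with x hx _ using hx
      · exact ae_of_all _ fun x h => absurd h hi
    refine ⟨_, (ae_ae_condExpKernel (hle' (j + 1)) hG).and (hlaw.and (hconst.and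
      (ae_condExpKernel_eq_self (hle' (j + 1)) (T.measurable_Y_tailSigma hjk)))), ?_⟩
    rintro x ⟨hx1, hx2, hx3, hx4⟩ y ⟨hy1, hy2, hy3, hy4⟩
    obtain ⟨ψ, hψ1, hψ2, hψ⟩ := exists_coupling (hX j)
      (condExpKernel μ (tailSigma T.X (j + 1)) x) (condExpKernel μ (tailSigma T.X (j + 1)) y)
    refine (kantorovich_le hψ1 hψ2 hx1 hy1 hGle).trans ?_
    gcongr
    -- Agreement gives equal `Y (j + 1)`, hence equal conditional laws of `X j`, so the coupling
    -- matches `X j` almost surely; later coordinates are constant under each conditional measure.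
    -- Without agreement the bound 1 is trivial.
    by_cases h : (x, y) ∈ T.agree (j + 1) k
    · rw [Set.indicator_of_notMem (by simpa using h)]
      have hY : T.Y (j + 1) x = T.Y (j + 1) y := T.Y_eq_of_mem_agree hjk h
      have hψ0 : ∀ᵐ z ∂ψ, T.X j z.1 = T.X j z.2 := by
        refine le_antisymm (hψ.trans_eq (Finset.sum_eq_zero fun a _ => ?_)) zero_le
        rw [hx2, hy2, hY, tsub_self]
      have e1 : ∀ᵐ z ∂ψ, ∀ i, j + 1 ≤ i → T.X i z.1 = T.X i x := by
        refine ae_of_ae_map (p := fun z => ∀ i, j + 1 ≤ i → T.X i z = T.X i x)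
          measurable_fst.aemeasurable ?_
        rw [hψ1]
        exact ae_all_iff.2 fun i => Filter.eventually_imp_distrib_left.2 (hx3 i)
      have e2 : ∀ᵐ z ∂ψ, ∀ i, j + 1 ≤ i → T.X i z.2 = T.X i y := by
        refine ae_of_ae_map (p := fun z => ∀ i, j + 1 ≤ i → T.X i z = T.X i y)
          measurable_snd.aemeasurable ?_
        rw [hψ2]
        exact ae_all_iff.2 fun i => Filter.eventually_imp_distrib_left.2 (hy3 i)
      have e3 : ∀ᵐ z ∂ψ, T.Y k z.1 = T.Y k x :=
        ae_of_ae_map (p := fun z => T.Y k z = T.Y k x) measurable_fst.aemeasurable (hψ1 ▸ hx4)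
      have e4 : ∀ᵐ z ∂ψ, T.Y k z.2 = T.Y k y :=
        ae_of_ae_map (p := fun z => T.Y k z = T.Y k y) measurable_snd.aemeasurable (hψ2 ▸ hy4)
      have : ∀ᵐ z ∂ψ, z ∈ T.agree j k := by
        filter_upwards [hψ0, e1, e2, e3, e4] with z h0 h1 h2 h3 h4
        refine ⟨fun i hi hik => ?_, h3.trans (h.2.trans h4.symm)⟩
        rcases hi.eq_or_lt with rfl | hlt
        · exact h0
        · exact (h1 i hlt).trans ((h.1 i hlt hik).trans (h2 i hlt).symm)
      exact (mem_ae_iff.1 this).le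
    · rw [Set.indicator_of_mem (Set.mem_compl h), Pi.one_apply]
      refine (measure_mono (Set.subset_univ _)).trans ?_
      rw [← Set.preimage_univ (f := Prod.fst),
        ← Measure.map_apply measurable_fst MeasurableSet.univ, hψ1, measure_univ]

lemma lintegral_pathTransfer_succ_le (hA0 : A 0 = mΩ) (hA : Antitone A)
    (hfin : IsFiniteType μ A) (k : ℕ) :
    ∫⁻ p, T.pathTransfer (k + 1) p.1 p.2 ∂(μ.prod μ) ≤ 3 * 2⁻¹ ^ k := by
  have hle : ∀ n, A n ≤ mΩ := fun n => (hA (Nat.zero_le n)).trans hA0.le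
  have hle' : ∀ i, tailSigma T.X i ≤ mΩ := fun i => (T.tailSigma_le hA i).trans (hle _)
  have hY : Measurable (T.Y k) := (T.measurable_Y_tailSigma le_rfl).mono (hle' k) le_rfl
  have hYa : ∀ a, MeasurableSet (T.Y k ⁻¹' {a}) := fun a => hY (measurableSet_singleton a)
  obtain ⟨c, hc⟩ := T.mixing k
  have hκ : ∀ a, Measurable fun x => condExpKernel μ (A (T.n (k + 1))) x (T.Y k ⁻¹' {a}) :=
    fun a => (measurable_condExpKernel (hYa a)).mono (hle _) le_rfl
  have hFa : ∀ a, Measurable fun x =>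
      (condExpKernel μ (A (T.n (k + 1))) x (T.Y k ⁻¹' {a}) - c a) +
        (c a - condExpKernel μ (A (T.n (k + 1))) x (T.Y k ⁻¹' {a})) := fun a =>
    ((hκ a).sub_const _).add ((hκ a).const_sub _)
  rw [← lintegral_finsetSum _ fun a _ => hFa a] at hc
  set F : Ω → ℝ≥0∞ := fun x => ∑ a,
    ((condExpKernel μ (A (T.n (k + 1))) x (T.Y k ⁻¹' {a}) - c a) +
      (c a - condExpKernel μ (A (T.n (k + 1))) x (T.Y k ⁻¹' {a}))) with hFdef
  have hF : Measurable F := Finset.measurable_sum _ fun a _ => hFa a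
  -- With both times equal to `k`, agreement means only equality of `Y k`.
  obtain ⟨G, hG, hGle⟩ := T.exists_pathTransfer_le_agree hA0 hA hfin (le_refl k)
  have hgood := (ae_ae_condExpKernel (hle' (k + 1)) hG).and (ae_all_iff.2 fun a =>
    T.condExpKernel_tailSigma_ae_eq hA0 hA hfin (k + 1) (hYa a))
  have hbound : ∀ᵐ p ∂(μ.prod μ), T.pathTransfer (k + 1) p.1 p.2 ≤ F p.1 + F p.2 + 2⁻¹ ^ k := by
    filter_upwards [Measure.quasiMeasurePreserving_fst.ae hgood,
      Measure.quasiMeasurePreserving_snd.ae hgood] with p h1 h2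
    obtain ⟨ψ, hψ1, hψ2, hψ⟩ := exists_coupling hY
      (condExpKernel μ (tailSigma T.X (k + 1)) p.1) (condExpKernel μ (tailSigma T.X (k + 1)) p.2)
    refine (kantorovich_le hψ1 hψ2 h1.1 h2.1 hGle).trans ?_
    gcongr
    have hagree : (T.agree k k)ᶜ = {z | T.Y k z.1 ≠ T.Y k z.2} := by
      ext z
      simp only [agree, Set.mem_compl_iff, Set.mem_ofPred_eq, ne_eq, not_iff_not]
      exact ⟨fun h => h.2, fun h => ⟨fun i h1 h2 => absurd h2 (not_lt.2 h1), h⟩⟩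
    rw [hagree]
    refine hψ.trans ?_
    rw [hFdef, ← Finset.sum_add_distrib]
    refine Finset.sum_le_sum fun a _ => ?_
    rw [h1.2 a, h2.2 a]
    -- The conditional laws at the two points are compared through the deterministic `c`; one
    -- truncated difference goes to each point.
    refine (tsub_le_tsub_add_tsub (b := c a)).trans ?_
    gcongr
    · exact le_self_add
    · exact le_add_self
  calc ∫⁻ p, T.pathTransfer (k + 1) p.1 p.2 ∂(μ.prod μ)
      ≤ ∫⁻ p, (F p.1 + F p.2 + 2⁻¹ ^ k) ∂(μ.prod μ) := lintegral_mono_ae hbound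
    _ = ∫⁻ x, F x ∂μ + ∫⁻ x, F x ∂μ + 2⁻¹ ^ k := by
        rw [lintegral_add_right _ measurable_const,
          lintegral_add_left (f := fun p : Ω × Ω => F p.1) (hF.comp measurable_fst), lintegral_const, measure_univ, mul_one,
          measurePreserving_fst.lintegral_comp hF, measurePreserving_snd.lintegral_comp hF]
    _ ≤ 2⁻¹ ^ k + 2⁻¹ ^ k + 2⁻¹ ^ k := by gcongr
    _ = 3 * 2⁻¹ ^ k := by ring

theorem isStandard (hA0 : A 0 = mΩ) (hA : Antitone A) (hfin : IsFiniteType μ A)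
    (herg : IsErgodic μ A) : IsStandard μ fun k => A (T.n k) := by
  refine ⟨T.s, T.X, fun k => T.eventuallyMeasurableSpace_eq hA0 hA hfin k,
    T.isMarkovChain hA0 hA, T.isErgodic hA herg, pathDist, isAlmostCylinderMetric_pathDist, ?_⟩
  rw [← tendsto_add_atTop_iff_nat 1]
  have hlim : Tendsto (fun k : ℕ => 3 * (2⁻¹ : ℝ≥0∞) ^ k) atTop (𝓝 0) := by
    simpa using ENNReal.Tendsto.const_mul (a := 3)
      (ENNReal.tendsto_pow_atTop_nhds_zero_of_lt_one (by simp : (2⁻¹ : ℝ≥0∞) < 1))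
      (Or.inr (by simp))
  exact tendsto_of_tendsto_of_tendsto_of_le_of_le tendsto_const_nhds hlim (fun _ => zero_le)
    fun k => T.lintegral_pathTransfer_succ_le hA0 hA hfin k

end Tower

end DecFiltration

theorem mainTheorem4 {Ω : Type*} [mΩ : MeasurableSpace Ω] [StandardBorelSpace Ω]
    (μ : Measure Ω) [IsProbabilityMeasure μ] [NullSingletonClass μ]
    (A : ℕ → MeasurableSpace Ω) (hA : Antitone A) (hA0 : A 0 = mΩ)
    (hfin : DecFiltration.IsFiniteType μ A) (herg : DecFiltration.IsErgodic μ A) :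
    ∃ n : ℕ → ℕ, n 0 = 0 ∧ StrictMono n ∧
      DecFiltration.IsStandard μ (fun k => A (n k)) := by
  obtain ⟨T⟩ := DecFiltration.exists_tower hA hA0 hfin herg
  exact ⟨T.n, T.n_zero, T.n_strictMono, T.isStandard hA0 hA hfin herg⟩
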